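/- Let $X$ and $U$ be finite state and action spaces, let $Y$ be a measurable observation space, and consider the system $$x_{t+1}=f(x_t,u_t,w_t),\qquad y_t=g(x_t,v_t),$$ with measurable $f,g$, where $\{w_t\}$ and $\{v_t\}$ are i.i.d. noise sequences, independent of each other and of $x_0$, with unknown laws. Let $\mathcal T(\cdot|x,u)$ be the law of $f(x,u,w_0)$ and $Q(\cdot|x)$ the law of $g(x,v_0)$. Let $c:X\times U\to\mathbb R$ be a stage cost, $\beta\in(0,1)$ and $P$ a fixed probability measure on $X$. An admissible policy $\gamma=(\gamma_t)_{t\ge0}$ consists of measurable control functions $u_t=\gamma_t(y_0,\dots,y_t,u_0,\dots,u_{t-1})$. For a transition kernel $\mathcal S$ put $$J_\beta(\mathcal S,\gamma)=E^{\mathcal S,\gamma}_P\Big[\sum_{t=0}^\infty\beta^t c(x_t,u_t)\Big],\qquad J^*_\beta(\mathcal S)=\inf_\gamma J_\beta(\mathcal S,\gamma),$$ where $E^{\mathcal S,\gamma}_P$ is the expectation when $x_0\sim P$, the transition kernel is $\mathcal S$, the observation channel is $Q$ and the policy is $\gamma$; the infimum is over all admissible policies. A policy $\gamma$ is optimal for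 $\mathcal S$ if $J_\beta(\mathcal S,\gamma)=J^*_\beta(\mathcal S)$. Let $(X_t,Y_t,U_t)_{t\ge0}$ be a training run of the system, with any initial distribution and controlled by some non-anticipative policy (which may use the past and present states and observations, the past actions, and a random seed; the pair consisting of $X_0$ and the seed is independent of the noises), such that almost surely every pair $(x,u)\in X\times U$ is visited infinitely often. For $n\ge1$ let $$\mathcal T_n(B|x,u)=\frac{\sum_{i=1}^n 1_{\{X_i\in B,\;X_{i-1}=x,\;U_{i-1}=u\}}}{\sum_{i=1}^n 1_{\{X_{i-1}=x,\;U_{i-1}=u\}}},\qquad B\subset X,$$ with $\mathcal T_n(\cdot|x,u)$ equal to an arbitrary prescribed probability measure $d(\cdot|x,u)$ as long as the denominator is $0$. Then, almost surely, $$J^*_\beta(\mathcal T_n)\to J^*_\beta(\mathcal T)\quad (n\to\infty),$$ and, for every sequence $(\gamma_n^*)_{n\ge1}$ of admissible policies such that $\gamma_n^*$ is optimal for $\mathcal T_n$ for every $n\ge1$, $$J_\beta(\mathcal T,\gamma_n^*)\to J^*_\beta(\mathcal T)\quad (n\to\infty).$$ -/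

import Mathlib

open MeasureTheory ProbabilityTheory Filter Topology

/-- A partially observed controlled system `x_{t+1} = f (x_t, u_t, w_t)`, `y_t = g (x_t, v_t)`,
together with the common law `μ` of the i.i.d. noise `w_t` and the common law `ν` of the i.i.d.
measurement noise `v_t`. -/
structure ControlledSystem (X U Y W V : Type*) [MeasurableSpace X] [MeasurableSpace U]
    [MeasurableSpace Y] [MeasurableSpace W] [MeasurableSpace V] where
  f : X → U → W → X
  measurable_f : Measurable fun p : (X × U) × W => f p.1.1 p.1.2 p.2
  g : X → V → Y
  measurable_g : Measurable fun p : X × V => g p.1 p.2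
  μ : ProbabilityMeasure W
  ν : ProbabilityMeasure V

namespace ControlledSystem

variable {X U Y W V : Type*} [MeasurableSpace X] [MeasurableSpace U]
  [MeasurableSpace Y] [MeasurableSpace W] [MeasurableSpace V]

/-- The true transition kernel: `𝒯 (· | x, u)` is the law of `f (x, u, w)` for `w ∼ μ`. -/
noncomputable def transition (S : ControlledSystem X U Y W V) : Kernel (X × U) X :=
  (Kernel.id ×ₖ Kernel.const (X × U) (S.μ : Measure W)).map
    fun p : (X × U) × W => S.f p.1.1 p.1.2 p.2

instance (S : ControlledSystem X U Y W V) : IsMarkovKernel S.transition :=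
  Kernel.IsMarkovKernel.map _ S.measurable_f

lemma transition_apply (S : ControlledSystem X U Y W V) (x : X) (u : U) :
    S.transition (x, u) = (S.μ : Measure W).map (S.f x u) := by
  rw [transition, Kernel.map_apply _ S.measurable_f, Kernel.prod_apply, Kernel.id_apply,
    Kernel.const_apply, Measure.dirac_prod, Measure.map_map S.measurable_f (by fun_prop)]
  rfl

/-- The observation channel: `Q (· | x)` is the law of `g (x, v)` for `v ∼ ν`. -/
noncomputable def channel (S : ControlledSystem X U Y W V) : Kernel X Y :=
  (Kernel.id ×ₖ Kernel.const X (S.ν : Measure V)).map fun p : X × V => S.g p.1 p.2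

instance (S : ControlledSystem X U Y W V) : IsMarkovKernel S.channel :=
  Kernel.IsMarkovKernel.map _ S.measurable_g

lemma channel_apply (S : ControlledSystem X U Y W V) (x : X) :
    S.channel x = (S.ν : Measure V).map (S.g x) := by
  rw [channel, Kernel.map_apply _ S.measurable_g, Kernel.prod_apply, Kernel.id_apply,
    Kernel.const_apply, Measure.dirac_prod, Measure.map_map S.measurable_g (by fun_prop)]
  rfl

end ControlledSystem

/-- An admissible policy: measurable control functions `u_t = γ_t (y_{[0,t]}, u_{[0,t-1]})`. -/
structure AdmissiblePolicy (Y U : Type*) [MeasurableSpace Y] [MeasurableSpace U] where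
  act : ∀ t : ℕ, (Finset.Iic t → Y) → (Finset.Iio t → U) → U
  measurable_act : ∀ t,
    Measurable fun p : (Finset.Iic t → Y) × (Finset.Iio t → U) => act t p.1 p.2

section StrategicMeasure

variable {X Y U : Type*} [MeasurableSpace X] [MeasurableSpace Y] [MeasurableSpace U]

/-- The action at time `0`, as a function of the first observation. -/
def firstAction (γ : AdmissiblePolicy Y U) (y : Y) : U :=
  γ.act 0 (fun _ => y) fun i => absurd (Finset.mem_Iio.1 i.2) (Nat.not_lt_zero _)

lemma measurable_firstAction (γ : AdmissiblePolicy Y U) : Measurable (firstAction γ) := by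
  refine (γ.measurable_act 0).comp (g := fun p : (Finset.Iic 0 → Y) × (Finset.Iio 0 → U) =>
    γ.act 0 p.1 p.2) (Measurable.prodMk ?_ ?_)
  · exact measurable_pi_lambda _ fun _ => measurable_id
  · exact measurable_const

/-- The action at time `n + 1`, given the history `(x, y, u)_{[0,n]}` and the new observation. -/
def nextAction (γ : AdmissiblePolicy Y U) (n : ℕ) (h : Finset.Iic n → X × Y × U) (y : Y) : U :=
  γ.act (n + 1)
    (fun i => if hi : (i : ℕ) ≤ n then (h ⟨i, Finset.mem_Iic.2 hi⟩).2.1 else y)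
    (fun i => (h ⟨i, Finset.mem_Iic.2 (Nat.lt_succ_iff.1 (Finset.mem_Iio.1 i.2))⟩).2.2)

lemma measurable_nextAction (γ : AdmissiblePolicy Y U) (n : ℕ) :
    Measurable fun p : (Finset.Iic n → X × Y × U) × Y => nextAction γ n p.1 p.2 := by
  refine (γ.measurable_act (n + 1)).comp
    (g := fun p : (Finset.Iic (n + 1) → Y) × (Finset.Iio (n + 1) → U) =>
      γ.act (n + 1) p.1 p.2) (Measurable.prodMk ?_ ?_)
  · refine measurable_pi_lambda _ fun i => ?_
    by_cases hi : (i : ℕ) ≤ n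
    · have e : Measurable fun p : (Finset.Iic n → X × Y × U) × Y =>
          (p.1 ⟨i, Finset.mem_Iic.2 hi⟩).2.1 := by fun_prop
      convert e using 2
      exact dif_pos hi
    · convert (measurable_snd : Measurable fun p : (Finset.Iic n → X × Y × U) × Y => p.2) using 2
      exact dif_neg hi
  · exact measurable_pi_lambda _ fun i => by fun_prop

/-- The law of `(x_0, y_0, u_0)`: `P(dx_0) Q(dy_0 | x_0) 1{γ_0(y_0) ∈ du_0}`. -/
noncomputable def firstStepLaw (P : Measure X) (Q : Kernel X Y) (γ : AdmissiblePolicy Y U) :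
    Measure (X × Y × U) :=
  (P ⊗ₘ Q).map fun p => (p.1, p.2, firstAction γ p.2)

instance (P : Measure X) [IsProbabilityMeasure P] (Q : Kernel X Y) [IsMarkovKernel Q]
    (γ : AdmissiblePolicy Y U) : IsProbabilityMeasure (firstStepLaw P Q γ) := by
  have h := measurable_firstAction γ
  exact Measure.isProbabilityMeasure_map (by fun_prop)

/-- The conditional law of `(x, y, u)_{n+1}` given `(x, y, u)_{[0,n]}`:
`𝒯(dx_{n+1} | x_n, u_n) Q(dy_{n+1} | x_{n+1}) 1{γ_{n+1}(y_{[0,n+1]}, u_{[0,n]}) ∈ du_{n+1}}`. -/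
noncomputable def stepKernel (T : Kernel (X × U) X) (Q : Kernel X Y) (γ : AdmissiblePolicy Y U)
    (n : ℕ) : Kernel (Finset.Iic n → X × Y × U) (X × Y × U) :=
  let last : Finset.Iic n := ⟨n, Finset.mem_Iic.2 le_rfl⟩
  let newXY : Kernel (Finset.Iic n → X × Y × U) (X × Y) :=
    (T.comap (fun h => ((h last).1, (h last).2.2)) (by fun_prop)) ⊗ₖ Kernel.prodMkLeft _ Q
  (Kernel.id ×ₖ newXY).map fun p => (p.2.1, p.2.2, nextAction γ n p.1 p.2.2)

instance (T : Kernel (X × U) X) [IsMarkovKernel T] (Q : Kernel X Y) [IsMarkovKernel Q]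
    (γ : AdmissiblePolicy Y U) (n : ℕ) : IsMarkovKernel (stepKernel T Q γ n) := by
  have h := (measurable_nextAction (X := X) γ n).comp
    (f := fun p : (Finset.Iic n → X × Y × U) × X × Y => (p.1, p.2.2)) (by fun_prop)
  exact Kernel.IsMarkovKernel.map _
    ((measurable_fst.comp measurable_snd).prodMk ((measurable_snd.comp measurable_snd).prodMk h))

/-- The strategic measure of a policy on `(X × Y × U)^ℕ`, by the Ionescu-Tulcea theorem. -/
noncomputable def strategicMeasure (P : Measure X) (T : Kernel (X × U) X) [IsMarkovKernel T]
    (Q : Kernel X Y) [IsMarkovKernel Q] (γ : AdmissiblePolicy Y U) : Measure (ℕ → X × Y × U) :=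
  Kernel.trajMeasure (X := fun _ => X × Y × U) (firstStepLaw P Q γ) (stepKernel T Q γ)

/-- The discounted cost `J_β (P, 𝒯, γ) = E [∑ β^t c (x_t, u_t)]`. -/
noncomputable def discountedCost (β : ℝ) (c : X → U → ℝ) (P : Measure X)
    (T : Kernel (X × U) X) [IsMarkovKernel T] (Q : Kernel X Y) [IsMarkovKernel Q]
    (γ : AdmissiblePolicy Y U) : ℝ :=
  ∫ z, ∑' t : ℕ, β ^ t * c (z t).1 (z t).2.2 ∂(strategicMeasure P T Q γ)

/-- The optimal cost `J_β^* (P, 𝒯) = inf_γ J_β (P, 𝒯, γ)`, over all admissible policies. -/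
noncomputable def optimalCost (β : ℝ) (c : X → U → ℝ) (P : Measure X)
    (T : Kernel (X × U) X) [IsMarkovKernel T] (Q : Kernel X Y) [IsMarkovKernel Q] : ℝ :=
  ⨅ γ : AdmissiblePolicy Y U, discountedCost β c P T Q γ

/-- The policy `γ` is optimal for the model with transition kernel `𝒯`. -/
def IsOptimalPolicy (β : ℝ) (c : X → U → ℝ) (P : Measure X)
    (T : Kernel (X × U) X) [IsMarkovKernel T] (Q : Kernel X Y) [IsMarkovKernel Q]
    (γ : AdmissiblePolicy Y U) : Prop :=
  discountedCost β c P T Q γ = optimalCost β c P T Q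

end StrategicMeasure

section Empirical

variable {X U : Type*}

open Classical in
/-- The times `i - 1 ∈ {0, …, n - 1}` at which the pair `(x, u)` is visited. -/
noncomputable def visitTimes (xs : ℕ → X) (us : ℕ → U) (n : ℕ) (x : X) (u : U) : Finset ℕ :=
  (Finset.range n).filter fun i => xs i = x ∧ us i = u

variable [MeasurableSpace X] [MeasurableSpace U]

open Classical in
/-- The empirical transition frequencies of a path up to time `n`, as a measure on `X`:
`B ↦ (∑_{i=1}^n 1{x_i ∈ B, x_{i-1} = x, u_{i-1} = u}) / (∑_{i=1}^n 1{x_{i-1} = x, u_{i-1} = u})`.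
For a pair that has not been visited yet (where the quotient is `0 / 0`), the estimate is a
prescribed initial guess `d (· | x, u)`. -/
noncomputable def empiricalMeasure (d : Kernel (X × U) X) (xs : ℕ → X) (us : ℕ → U) (n : ℕ)
    (x : X) (u : U) : Measure X :=
  if visitTimes xs us n x u = ∅ then d (x, u)
  else ((visitTimes xs us n x u).card : ENNReal)⁻¹ •
    ∑ i ∈ visitTimes xs us n x u, Measure.dirac (xs (i + 1))

open Classical in
lemma empiricalMeasure_apply (d : Kernel (X × U) X) (xs : ℕ → X) (us : ℕ → U) (n : ℕ)
    (x : X) (u : U) (h : visitTimes xs us n x u ≠ ∅) {B : Set X} (hB : MeasurableSet B) :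
    empiricalMeasure d xs us n x u B =
      (((Finset.range n).filter fun i => xs (i + 1) ∈ B ∧ xs i = x ∧ us i = u).card : ENNReal) /
        (((Finset.range n).filter fun i => xs i = x ∧ us i = u).card : ENNReal) := by
  rw [empiricalMeasure, if_neg h]
  simp only [Measure.smul_apply, Measure.finsetSum_apply, Measure.dirac_apply' _ hB, smul_eq_mul,
    visitTimes, Set.indicator_apply, Pi.one_apply]
  rw [Finset.sum_boole, Finset.filter_filter, ENNReal.div_eq_inv_mul]
  simp only [and_comm]

instance (d : Kernel (X × U) X) [IsMarkovKernel d] (xs : ℕ → X) (us : ℕ → U) (n : ℕ)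
    (x : X) (u : U) : IsProbabilityMeasure (empiricalMeasure d xs us n x u) := by
  unfold empiricalMeasure
  split_ifs with h
  · infer_instance
  · constructor
    simp only [Measure.smul_apply, Measure.finsetSum_apply, measure_univ, Finset.sum_const,
      nsmul_eq_mul, mul_one, smul_eq_mul]
    exact ENNReal.inv_mul_cancel (by simpa using h) (ENNReal.natCast_ne_top _)

variable [Finite X] [Finite U] [MeasurableSingletonClass X] [MeasurableSingletonClass U]

/-- The empirical transition kernel `𝒯_n` of a path. -/
noncomputable def empiricalKernel (d : Kernel (X × U) X) (xs : ℕ → X) (us : ℕ → U) (n : ℕ) :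
    Kernel (X × U) X :=
  Kernel.ofFunOfCountable fun p => empiricalMeasure d xs us n p.1 p.2

instance (d : Kernel (X × U) X) [IsMarkovKernel d] (xs : ℕ → X) (us : ℕ → U) (n : ℕ) :
    IsMarkovKernel (empiricalKernel d xs us n) :=
  ⟨fun p => inferInstanceAs (IsProbabilityMeasure (empiricalMeasure d xs us n p.1 p.2))⟩

end Empirical

/-- A training policy: a measurable non-anticipative rule
`u_t = η_t (r, x_{[0,t]}, y_{[0,t]}, u_{[0,t-1]})`, where `r` is a randomization seed. Admissible
policies are the special case in which neither `r` nor the states are used. -/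
structure TrainingPolicy (R X Y U : Type*) [MeasurableSpace R] [MeasurableSpace X]
    [MeasurableSpace Y] [MeasurableSpace U] where
  act : ∀ t : ℕ, R → (Finset.Iic t → X) → (Finset.Iic t → Y) → (Finset.Iio t → U) → U
  measurable_act : ∀ t, Measurable
    fun p : R × (Finset.Iic t → X) × (Finset.Iic t → Y) × (Finset.Iio t → U) =>
      act t p.1 p.2.1 p.2.2.1 p.2.2.2

/-- On the probability space `(Ω, Pr)`, the processes `x, y, u` are a run of the system `S` that is
driven by the noises `w, v` and controlled by the training policy `η` with seed `r`: the noises are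
i.i.d. with the laws prescribed by `S`, and they are independent of each other and of
`(x_0, r)`. -/
structure IsTrainingRun {Ω R X U Y W V : Type*} [MeasurableSpace Ω] [MeasurableSpace R]
    [MeasurableSpace X] [MeasurableSpace U] [MeasurableSpace Y] [MeasurableSpace W]
    [MeasurableSpace V] (Pr : Measure Ω) (S : ControlledSystem X U Y W V)
    (η : TrainingPolicy R X Y U) (r : Ω → R) (w : ℕ → Ω → W) (v : ℕ → Ω → V)
    (x : ℕ → Ω → X) (y : ℕ → Ω → Y) (u : ℕ → Ω → U) : Prop where
  measurable_r : Measurable r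
  measurable_w : ∀ t, Measurable (w t)
  measurable_v : ∀ t, Measurable (v t)
  measurable_x0 : Measurable (x 0)
  law_w : ∀ t, Pr.map (w t) = S.μ
  law_v : ∀ t, Pr.map (v t) = S.ν
  indep_w : iIndepFun w Pr
  indep_v : iIndepFun v Pr
  indep_w_v : IndepFun (fun ω t => w t ω) (fun ω t => v t ω) Pr
  indep_x0_r : IndepFun (fun ω => (x 0 ω, r ω)) (fun ω => (fun t => w t ω, fun t => v t ω)) Pr
  state_eq : ∀ t ω, x (t + 1) ω = S.f (x t ω) (u t ω) (w t ω)
  obs_eq : ∀ t ω, y t ω = S.g (x t ω) (v t ω)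
  act_eq : ∀ t ω, u t ω =
    η.act t (r ω) (fun i => x i ω) (fun i => y i ω) (fun i => u i ω)

/-! ### Lipschitz dependence of the discounted cost on the transition kernel, uniformly in the
policy. -/

section CostContinuity

variable {X Y U : Type*} [MeasurableSpace X] [MeasurableSpace Y] [MeasurableSpace U]

/-! The proof splits into a deterministic estimate and a law of large numbers.

Fix a policy and run it under two kernels. The two laws of the history differ only through the
transition draws, so replacing one kernel by the other, one step at a time, changes the expected
cost at time `t` by at most `t` times the ℓ¹ distance of the kernels times the sup of the cost.
Since `∑ t * β ^ t` converges, the discounted cost is Lipschitz in the kernel with a constant that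
does not depend on the policy (`exists_abs_discountedCost_sub_le`). This uniformity gives both
conclusions: infima over policies are then Lipschitz as well, and a policy optimal for a nearby
kernel has almost the same cost under the true one.

It remains to show that the empirical kernel converges entrywise (`ae_tendsto_empiricalKernel`). At
a visit to `(a, b)` the next state is `a'` exactly when the fresh noise lies in a fixed set, so the
estimation error is an average of centred noise terms over the visit times. Whether time `t` is a
visit depends only on the past, of which the noise `w t` is independent. The sum of these terms,
each divided by the running visit count, is therefore an L²-bounded martingale; it converges almost
surely, and a Kronecker argument gives the claim (`ae_tendsto_selected_average_zero`). -/

instance (P : Measure X) [IsProbabilityMeasure P] (T : Kernel (X × U) X) [IsMarkovKernel T]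
    (Q : Kernel X Y) [IsMarkovKernel Q] (γ : AdmissiblePolicy Y U) :
    IsProbabilityMeasure (strategicMeasure P T Q γ) := by
  unfold strategicMeasure
  infer_instance

/-- Appending one more coordinate to a finite history. -/
def snocHistory {E : Type*} (n : ℕ) (p : (Finset.Iic n → E) × E) : Finset.Iic (n + 1) → E :=
  fun i => if hi : (i : ℕ) ≤ n then p.1 ⟨i, Finset.mem_Iic.2 hi⟩ else p.2

lemma measurable_snocHistory {E : Type*} [MeasurableSpace E] (n : ℕ) :
    Measurable (snocHistory (E := E) n) := by
  refine measurable_pi_lambda _ fun i => ?_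
  unfold snocHistory
  by_cases hi : (i : ℕ) ≤ n
  · simp only [hi, dite_true]; fun_prop
  · simp only [hi, dite_false]; fun_prop

lemma snocHistory_frestrictLe {E : Type*} (n : ℕ) (z : ℕ → E) :
    snocHistory n (Preorder.frestrictLe n z, z (n + 1)) = Preorder.frestrictLe (n + 1) z := by
  ext i
  by_cases hi : (i : ℕ) ≤ n
  · simp [snocHistory, hi]
  · have : (i : ℕ) = n + 1 := le_antisymm (Finset.mem_Iic.1 i.2) (by omega)
    simp [snocHistory, this]

/-- No transition has occurred at time `0`, so the right-hand side is free of `T`: the base case for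
comparing two kernels. -/
lemma strategicMeasure_map_frestrictLe_zero (P : Measure X) [IsProbabilityMeasure P]
    (T : Kernel (X × U) X) [IsMarkovKernel T] (Q : Kernel X Y) [IsMarkovKernel Q]
    (γ : AdmissiblePolicy Y U) :
    (strategicMeasure P T Q γ).map (Preorder.frestrictLe 0) =
      (firstStepLaw P Q γ).map (MeasurableEquiv.piUnique _).symm := by
  rw [strategicMeasure, Kernel.trajMeasure, Measure.map_comp _ _ (by fun_prop),
    Kernel.traj_map_frestrictLe, Kernel.partialTraj_self, Measure.id_comp]

/-- Tower property: the last coordinate is integrated out against its conditional law given the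
history. -/
lemma integral_strategicMeasure_succ (P : Measure X) [IsProbabilityMeasure P]
    (T : Kernel (X × U) X) [IsMarkovKernel T] (Q : Kernel X Y) [IsMarkovKernel Q]
    (γ : AdmissiblePolicy Y U) (n : ℕ) {h : (Finset.Iic (n + 1) → X × Y × U) → ℝ}
    (hm : Measurable h) {C : ℝ} (hC : ∀ z, |h z| ≤ C) :
    ∫ z, h (Preorder.frestrictLe (n + 1) z) ∂(strategicMeasure P T Q γ) =
      ∫ z, ∫ e, h (snocHistory n (Preorder.frestrictLe n z, e))
        ∂(stepKernel T Q γ n (Preorder.frestrictLe n z)) ∂(strategicMeasure P T Q γ) := by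
  have key : (strategicMeasure P T Q γ).map (Preorder.frestrictLe n) ⊗ₘ stepKernel T Q γ n =
      (strategicMeasure P T Q γ).map (fun x => (Preorder.frestrictLe n x, x (n + 1))) :=
    Kernel.map_frestrictLe_trajMeasure_compProd_eq_map_trajMeasure
      (X := fun _ => X × Y × U)
  have hms : Measurable fun p : (Finset.Iic n → X × Y × U) × (X × Y × U) =>
    h (snocHistory n p) := hm.comp (measurable_snocHistory n)
  have : IsProbabilityMeasure ((strategicMeasure P T Q γ).map
      (Preorder.frestrictLe (π := fun _ => X × Y × U) n)) :=
    Measure.isProbabilityMeasure_map (by fun_prop)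
  have hint : Integrable (fun p => h (snocHistory n p))
      ((strategicMeasure P T Q γ).map (Preorder.frestrictLe n) ⊗ₘ stepKernel T Q γ n) :=
    Integrable.of_bound hms.aestronglyMeasurable C (.of_forall fun p => hC _)
  have h1 := Measure.integral_compProd hint
  rw [key, integral_map (by fun_prop) hms.aestronglyMeasurable, integral_map (by fun_prop)] at h1
  · simpa only [snocHistory_frestrictLe] using h1
  · exact (hms.stronglyMeasurable.integral_kernel_prod_right').aestronglyMeasurable

/-- The kernel `T` enters only through the outer integral; the inner one is the same function of `a`
for every `T`. -/
lemma integral_stepKernel (T : Kernel (X × U) X) [IsMarkovKernel T] (Q : Kernel X Y)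
    [IsMarkovKernel Q] (γ : AdmissiblePolicy Y U) (n : ℕ) (z : Finset.Iic n → X × Y × U)
    {φ : X × Y × U → ℝ} (hm : Measurable φ) {C : ℝ} (hC : ∀ e, |φ e| ≤ C) :
    ∫ e, φ e ∂(stepKernel T Q γ n z) =
      ∫ a, ∫ b, φ (a, b, nextAction γ n z b) ∂(Q a)
        ∂(T ((z ⟨n, Finset.mem_Iic.2 le_rfl⟩).1, (z ⟨n, Finset.mem_Iic.2 le_rfl⟩).2.2)) := by
  have h1 := (measurable_nextAction (X := X) γ n).comp
    (f := fun p : (Finset.Iic n → X × Y × U) × X × Y => (p.1, p.2.2)) (by fun_prop)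
  have h2 : Measurable fun p : (Finset.Iic n → X × Y × U) × X × Y =>
      (p.2.1, p.2.2, nextAction γ n p.1 p.2.2) :=
    (measurable_fst.comp measurable_snd).prodMk ((measurable_snd.comp measurable_snd).prodMk h1)
  have h3 : Measurable fun p : (Finset.Iic n → X × Y × U) × X × Y =>
      φ (p.2.1, p.2.2, nextAction γ n p.1 p.2.2) := hm.comp h2
  rw [stepKernel, Kernel.map_apply _ h2, integral_map h2.aemeasurable hm.aestronglyMeasurable,
    Kernel.prod_apply, Kernel.id_apply, Measure.dirac_prod, integral_map (by fun_prop)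
      h3.aestronglyMeasurable, ProbabilityTheory.integral_compProd]
  · simp [Kernel.comap_apply, Kernel.prodMkLeft_apply]
  · exact Integrable.of_bound (h3.comp measurable_prodMk_left).aestronglyMeasurable C
      (.of_forall fun p => hC _)

lemma exists_abs_cost_le {X U : Type*} [Fintype X] [Fintype U] (c : X → U → ℝ) :
    ∃ C, 0 ≤ C ∧ ∀ x u, |c x u| ≤ C := by
  refine ⟨∑ p : X × U, |c p.1 p.2|, by positivity, fun x u => ?_⟩
  exact Finset.single_le_sum (f := fun p : X × U => |c p.1 p.2|) (fun _ _ => abs_nonneg _)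
    (Finset.mem_univ (x, u))

section Finite

variable [Fintype X] [Fintype U]

/-- The total `ℓ¹` distance between two transition kernels on finite spaces. -/
noncomputable def kernelDist (T T' : Kernel (X × U) X) : ℝ :=
  ∑ p : X × U, ∑ a : X, |(T p).real {a} - (T' p).real {a}|

lemma kernelDist_nonneg (T T' : Kernel (X × U) X) : 0 ≤ kernelDist T T' := by
  unfold kernelDist; positivity

variable [MeasurableSingletonClass X]

lemma abs_integral_sub_le_kernelDist (T T' : Kernel (X × U) X) [IsMarkovKernel T]
    [IsMarkovKernel T'] (p : X × U) {φ : X → ℝ} {C : ℝ} (hC : ∀ a, |φ a| ≤ C) :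
    |∫ a, φ a ∂(T p) - ∫ a, φ a ∂(T' p)| ≤ kernelDist T T' * C := by
  have hC0 : 0 ≤ C := by
    obtain ⟨a⟩ : Nonempty X := ⟨p.1⟩
    exact (abs_nonneg _).trans (hC a)
  rw [integral_fintype .of_finite, integral_fintype .of_finite, ← Finset.sum_sub_distrib]
  calc _ ≤ ∑ a : X, |(T p).real {a} - (T' p).real {a}| * C := by
        refine (Finset.abs_sum_le_sum_abs _ _).trans (Finset.sum_le_sum fun a _ => ?_)
        rw [← sub_smul, smul_eq_mul, abs_mul]
        exact mul_le_mul_of_nonneg_left (hC a) (abs_nonneg _)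
    _ = (∑ a : X, |(T p).real {a} - (T' p).real {a}|) * C := (Finset.sum_mul ..).symm
    _ ≤ _ := by
        refine mul_le_mul_of_nonneg_right ?_ hC0
        exact Finset.single_le_sum
          (f := fun p : X × U => ∑ a : X, |(T p).real {a} - (T' p).real {a}|)
          (fun _ _ => by positivity) (Finset.mem_univ p)

/-- Each of the `n` transitions contributes one error `kernelDist T T' * C`. Integrating out a step
preserves the bound `C`, so the errors add up without amplification. -/
lemma abs_integral_strategicMeasure_sub_le (P : Measure X) [IsProbabilityMeasure P]
    (T T' : Kernel (X × U) X) [IsMarkovKernel T] [IsMarkovKernel T'] (Q : Kernel X Y)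
    [IsMarkovKernel Q] (γ : AdmissiblePolicy Y U) (n : ℕ) {C : ℝ}
    {h : (Finset.Iic n → X × Y × U) → ℝ} (hm : Measurable h) (hC : ∀ z, |h z| ≤ C) :
    |∫ z, h (Preorder.frestrictLe n z) ∂(strategicMeasure P T Q γ) -
      ∫ z, h (Preorder.frestrictLe n z) ∂(strategicMeasure P T' Q γ)| ≤
      n * (kernelDist T T' * C) := by
  induction n with
  | zero =>
    have h0 (T : Kernel (X × U) X) [IsMarkovKernel T] :
        ∫ z, h (Preorder.frestrictLe 0 z) ∂(strategicMeasure P T Q γ) =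
          ∫ z, h z ∂((firstStepLaw P Q γ).map (MeasurableEquiv.piUnique _).symm) := by
      rw [← strategicMeasure_map_frestrictLe_zero P T Q γ,
        integral_map (by fun_prop) hm.aestronglyMeasurable]
    rw [h0 T, h0 T']
    simp
  | succ n ih =>
    have hms : Measurable fun p : (Finset.Iic n → X × Y × U) × (X × Y × U) =>
      h (snocHistory n p) := hm.comp (measurable_snocHistory n)
    rw [integral_strategicMeasure_succ P T Q γ n hm hC,
      integral_strategicMeasure_succ P T' Q γ n hm hC]
    -- `K T` is again a measurable function of the shorter history bounded by `C`, so the induction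
    -- hypothesis applies to `K T'`.
    set K : Kernel (X × U) X → (Finset.Iic n → X × Y × U) → ℝ := fun T z =>
      ∫ e, h (snocHistory n (z, e)) ∂(stepKernel T Q γ n z) with hK
    have hKm (T : Kernel (X × U) X) [IsMarkovKernel T] : Measurable (K T) :=
      hms.stronglyMeasurable.integral_kernel_prod_right'.measurable
    have hKC (T : Kernel (X × U) X) [IsMarkovKernel T] (z) : |K T z| ≤ C := by
      simpa using norm_integral_le_of_norm_le_const (μ := stepKernel T Q γ n z)
        (f := fun e => h (snocHistory n (z, e))) (.of_forall fun e => hC _)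
    have hKi (T T₀ : Kernel (X × U) X) [IsMarkovKernel T] [IsMarkovKernel T₀] :
        Integrable (fun z => K T (Preorder.frestrictLe n z)) (strategicMeasure P T₀ Q γ) :=
      Integrable.of_bound ((hKm T).comp (by fun_prop)).aestronglyMeasurable C
        (.of_forall fun z => hKC T _)
    have hd (z) : |K T z - K T' z| ≤ kernelDist T T' * C := by
      simp only [hK]
      have hz : Measurable fun e : X × Y × U => h (snocHistory n (z, e)) :=
        hms.comp measurable_prodMk_left
      rw [integral_stepKernel T Q γ n z hz fun e => hC _,
        integral_stepKernel T' Q γ n z hz fun e => hC _]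
      refine abs_integral_sub_le_kernelDist T T' _ fun a => ?_
      simpa using norm_integral_le_of_norm_le_const (μ := Q a)
        (f := fun b => h (snocHistory n (z, (a, b, nextAction γ n z b)))) (.of_forall fun e => hC _)
    have h1 : |∫ z, K T (Preorder.frestrictLe n z) ∂(strategicMeasure P T Q γ) -
        ∫ z, K T' (Preorder.frestrictLe n z) ∂(strategicMeasure P T Q γ)| ≤
        kernelDist T T' * C := by
      rw [← integral_sub (hKi T T) (hKi T' T)]
      simpa using norm_integral_le_of_norm_le_const (μ := strategicMeasure P T Q γ)
        (f := fun z => K T (Preorder.frestrictLe n z) - K T' (Preorder.frestrictLe n z))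
        (.of_forall fun z => hd _)
    -- The intermediate quantity uses `T` up to time `n` and `T'` for the last step.
    refine (abs_sub_le _ _ _).trans ((add_le_add h1 (ih (hKm T') (hKC T'))).trans_eq ?_)
    push_cast
    ring

variable [MeasurableSingletonClass U]

lemma hasSum_discountedCost {β : ℝ} (hβ0 : 0 < β) (hβ1 : β < 1) (c : X → U → ℝ) (P : Measure X)
    [IsProbabilityMeasure P] (T : Kernel (X × U) X) [IsMarkovKernel T] (Q : Kernel X Y)
    [IsMarkovKernel Q] (γ : AdmissiblePolicy Y U) :
    HasSum (fun t : ℕ => β ^ t * ∫ z, c (z t).1 (z t).2.2 ∂(strategicMeasure P T Q γ))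
      (discountedCost β c P T Q γ) := by
  obtain ⟨C, hC0, hC⟩ := exists_abs_cost_le c
  have hcm : Measurable fun p : X × U => c p.1 p.2 := measurable_of_finite _
  have hint (t : ℕ) : Integrable (fun z : ℕ → X × Y × U => β ^ t * c (z t).1 (z t).2.2)
      (strategicMeasure P T Q γ) :=
    (Integrable.of_bound (hcm.comp (g := fun p : X × U => c p.1 p.2)
      (f := fun z : ℕ → X × Y × U => ((z t).1, (z t).2.2)) (by fun_prop)).aestronglyMeasurable C
      (.of_forall fun z => hC _ _)).const_mul _
  have := hasSum_integral_of_summable_integral_norm hint ?_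
  · simp only [integral_const_mul] at this
    exact this
  · refine Summable.of_nonneg_of_le (fun t => integral_nonneg fun _ => norm_nonneg _) (fun t => ?_)
      ((summable_geometric_of_lt_one hβ0.le hβ1).mul_right C)
    have := norm_integral_le_of_norm_le_const (μ := strategicMeasure P T Q γ)
        (f := fun z => ‖β ^ t * c (z t).1 (z t).2.2‖) (C := β ^ t * C) (.of_forall fun z => by
          rw [norm_norm, norm_mul, norm_pow, Real.norm_of_nonneg hβ0.le]
          exact mul_le_mul_of_nonneg_left (hC _ _) (by positivity))
    simpa using (le_abs_self _).trans this

/-- Needed to make the infimum over policies a genuine one: a real `⨅` of a family unbounded below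
is a default value. -/
lemma exists_abs_discountedCost_le {β : ℝ} (hβ0 : 0 < β) (hβ1 : β < 1) (c : X → U → ℝ)
    (P : Measure X) [IsProbabilityMeasure P] (Q : Kernel X Y) [IsMarkovKernel Q] :
    ∃ B, ∀ (T : Kernel (X × U) X) [IsMarkovKernel T] (γ : AdmissiblePolicy Y U),
      |discountedCost β c P T Q γ| ≤ B := by
  obtain ⟨C, hC0, hC⟩ := exists_abs_cost_le c
  have hs := (summable_geometric_of_lt_one hβ0.le hβ1).mul_right C
  refine ⟨∑' t : ℕ, β ^ t * C, fun T _ γ => ?_⟩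
  rw [← (hasSum_discountedCost hβ0 hβ1 c P T Q γ).tsum_eq, ← Real.norm_eq_abs]
  refine tsum_of_norm_bounded hs.hasSum fun t => ?_
  rw [norm_mul, norm_pow, Real.norm_of_nonneg hβ0.le]
  refine mul_le_mul_of_nonneg_left ?_ (by positivity)
  simpa using norm_integral_le_of_norm_le_const (μ := strategicMeasure P T Q γ)
    (f := fun z => c (z t).1 (z t).2.2) (.of_forall fun z => hC _ _)

/-- The discounted cost is Lipschitz in the transition kernel, uniformly over all policies. -/
lemma exists_abs_discountedCost_sub_le {β : ℝ} (hβ0 : 0 < β) (hβ1 : β < 1) (c : X → U → ℝ)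
    (P : Measure X) [IsProbabilityMeasure P] (Q : Kernel X Y) [IsMarkovKernel Q] :
    ∃ L, 0 ≤ L ∧ ∀ (T T' : Kernel (X × U) X) [IsMarkovKernel T] [IsMarkovKernel T']
      (γ : AdmissiblePolicy Y U),
      |discountedCost β c P T Q γ - discountedCost β c P T' Q γ| ≤ L * kernelDist T T' := by
  obtain ⟨C, hC0, hC⟩ := exists_abs_cost_le c
  have hs : Summable fun t : ℕ => (t : ℝ) * β ^ t := by
    simpa using summable_pow_mul_geometric_of_norm_lt_one 1
      (by rwa [Real.norm_of_nonneg hβ0.le] : ‖β‖ < 1)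
  refine ⟨(∑' t : ℕ, (t : ℝ) * β ^ t) * C,
    mul_nonneg (tsum_nonneg fun t => by positivity) hC0, fun T T' _ _ γ => ?_⟩
  have h1 := (hasSum_discountedCost hβ0 hβ1 c P T Q γ).sub
    (hasSum_discountedCost hβ0 hβ1 c P T' Q γ)
  rw [← h1.tsum_eq, mul_assoc, ← Real.norm_eq_abs]
  refine tsum_of_norm_bounded (hs.hasSum.mul_right (C * kernelDist T T')) fun t => ?_
  have hcm : Measurable fun p : X × U => c p.1 p.2 := measurable_of_finite _
  have h2 := abs_integral_strategicMeasure_sub_le P T T' Q γ t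
    (h := fun z => c (z ⟨t, Finset.mem_Iic.2 le_rfl⟩).1 (z ⟨t, Finset.mem_Iic.2 le_rfl⟩).2.2)
    (hcm.comp (g := fun p : X × U => c p.1 p.2) (f := fun z : Finset.Iic t → X × Y × U =>
      ((z ⟨t, Finset.mem_Iic.2 le_rfl⟩).1, (z ⟨t, Finset.mem_Iic.2 le_rfl⟩).2.2)) (by fun_prop))
    fun z => hC _ _
  rw [← mul_sub, norm_mul, norm_pow, Real.norm_of_nonneg hβ0.le]
  calc _ ≤ β ^ t * (t * (kernelDist T T' * C)) := mul_le_mul_of_nonneg_left h2 (by positivity)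
    _ = _ := by ring

end Finite

end CostContinuity

/-! ### A strong law for predictably selected noise terms. -/

section MartingaleLaw

open Finset

/-- A Kronecker-type lemma: if the increments of a convergent sequence `s` are
`I n / (1 + ∑ i < n, I i) * ξ n`, then the `I`-weighted averages of `ξ` tend to `0`. -/
lemma tendsto_weighted_average_zero {I ξ s : ℕ → ℝ} {l : ℝ} (hI : 0 ≤ I) (hs0 : s 0 = 0)
    (hs : ∀ n, s (n + 1) = s n + I n / (1 + ∑ i ∈ range n, I i) * ξ n)
    (hl : Tendsto s atTop (𝓝 l)) (hN : Tendsto (fun n => ∑ i ∈ range n, I i) atTop atTop) :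
    Tendsto (fun n => (∑ i ∈ range n, I i * ξ i) / ∑ i ∈ range n, I i) atTop (𝓝 0) := by
  -- Summation by parts; the terms in `l` cancel. After division by `∑ I`, the last sum is a
  -- weighted Cesàro mean of a null sequence.
  have hid (n : ℕ) : ∑ i ∈ range n, I i * ξ i = s n + (∑ i ∈ range n, I i) * (s n - l) -
      ∑ i ∈ range n, I i * (s (i + 1) - l) := by
    induction n with
    | zero => simp [hs0]
    | succ n ih =>
      have hpos : (1 + ∑ i ∈ range n, I i) ≠ 0 := by
        have := Finset.sum_nonneg fun i (_ : i ∈ range n) => hI i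
        positivity
      have hmul : I n * ξ n = (1 + ∑ i ∈ range n, I i) * (s (n + 1) - s n) := by
        rw [hs n]; field_simp; ring
      rw [sum_range_succ, sum_range_succ, sum_range_succ, ih, hmul]
      ring
  have h0 : (fun n => s (n + 1) - l) =o[atTop] fun _ => (1 : ℝ) := by
    rw [Asymptotics.isLittleO_one_iff]
    simpa using (hl.comp (tendsto_add_atTop_nat 1)).sub_const l
  have h1 : (fun n => I n * (s (n + 1) - l)) =o[atTop] I := by
    simpa using (Asymptotics.isBigO_refl I atTop).mul_isLittleO h0
  have h2 := (h1.sum_range hI hN).tendsto_div_nhds_zero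
  have h3 := (hl.div_atTop hN).add (hl.sub_const l) |>.sub h2
  simp only [sub_self, add_zero] at h3
  refine h3.congr' ?_
  filter_upwards [hN.eventually_gt_atTop 0] with n hn
  rw [hid n]
  field_simp

/-- The `k`-th selected term contributes `1 / k ^ 2`, which is at most `2 / k - 2 / (k + 1)`; the
latter telescopes. -/
lemma sum_sq_div_le_two {I : ℕ → ℝ} (hI : ∀ n, I n = 0 ∨ I n = 1) (n : ℕ) :
    ∑ t ∈ range n, (I t / (1 + ∑ i ∈ range t, I i)) ^ 2 ≤ 2 := by
  have hI0 (n : ℕ) : 0 ≤ I n := by rcases hI n with h | h <;> simp [h]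
  have hN (n : ℕ) : 0 ≤ ∑ i ∈ range n, I i := Finset.sum_nonneg fun i _ => hI0 i
  suffices h : ∑ t ∈ range n, (I t / (1 + ∑ i ∈ range t, I i)) ^ 2 ≤
      2 - 2 / (1 + ∑ i ∈ range n, I i) by
    have := hN n
    have : 0 ≤ 2 / (1 + ∑ i ∈ range n, I i) := by positivity
    linarith
  induction n with
  | zero => simp
  | succ n ih =>
    rw [sum_range_succ, sum_range_succ (fun i => I i)]
    rcases hI n with h | h
    · simpa [h] using ih
    · rw [h]
      have := hN n
      generalize ∑ i ∈ range n, I i = m at *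
      have : (1 / (1 + m)) ^ 2 ≤ 2 / (1 + m) - 2 / (1 + (m + 1)) := by
        rw [div_sub_div _ _ (by positivity) (by positivity), div_pow,
          div_le_div_iff₀ (by positivity) (by positivity)]
        nlinarith
      linarith

variable {Ω : Type*} {mΩ : MeasurableSpace Ω} {Pr : Measure Ω} [IsProbabilityMeasure Pr]

/-- The strong law of large numbers for the selection `I` of terms of a centered bounded sequence
`ξ`, where each `ξ t` is independent of the past `ℱ t` and the selection is predictable. -/
lemma ae_tendsto_selected_average_zero (ℱ : Filtration ℕ mΩ) {I ξ : ℕ → Ω → ℝ}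
    (hIm : ∀ t, Measurable[ℱ t] (I t)) (hI : ∀ t ω, I t ω = 0 ∨ I t ω = 1)
    (hξm : ∀ t, Measurable[ℱ (t + 1)] (ξ t)) (hξ : ∀ t ω, |ξ t ω| ≤ 1)
    (hmean : ∀ t, ∫ ω, ξ t ω ∂Pr = 0)
    (hindep : ∀ t, Indep (MeasurableSpace.comap (ξ t) inferInstance) (ℱ t) Pr) :
    ∀ᵐ ω ∂Pr, Tendsto (fun n => ∑ i ∈ range n, I i ω) atTop atTop →
      Tendsto (fun n => (∑ i ∈ range n, I i ω * ξ i ω) / ∑ i ∈ range n, I i ω) atTop (𝓝 0) := by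
  have hI0 (t ω) : 0 ≤ I t ω := by rcases hI t ω with h | h <;> simp [h]
  -- The `1 +` counts a selection at time `t` itself, keeps the denominator positive, and leaves `A
  -- t` measurable with respect to `ℱ t`.
  set A : ℕ → Ω → ℝ := fun t ω => I t ω / (1 + ∑ i ∈ range t, I i ω) with hA
  set s : ℕ → Ω → ℝ := fun n ω => ∑ t ∈ range n, A t ω * ξ t ω with hs
  have hAm (t : ℕ) : Measurable[ℱ t] (A t) := by
    refine (hIm t).div (measurable_const.add ?_)
    refine Finset.measurable_fun_sum _ fun i hi => ?_
    exact (hIm i).mono (ℱ.mono (mem_range.1 hi).le) le_rfl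
  have hA1 (t ω) : |A t ω| ≤ 1 := by
    have := Finset.sum_nonneg fun i (_ : i ∈ range t) => hI0 i ω
    rw [abs_of_nonneg (div_nonneg (hI0 t ω) (by positivity)), div_le_one (by positivity)]
    rcases hI t ω with h | h <;> rw [h] <;> linarith
  have hAξ1 (t ω) : |A t ω * ξ t ω| ≤ 1 := by
    rw [abs_mul]; exact mul_le_one₀ (hA1 t ω) (abs_nonneg _) (hξ t ω)
  have hsm (n : ℕ) : Measurable[ℱ n] (s n) := by
    refine Finset.measurable_fun_sum _ fun t ht => ?_
    exact ((hAm t).mono (ℱ.mono (mem_range.1 ht).le) le_rfl).mul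
      ((hξm t).mono (ℱ.mono (mem_range.1 ht)) le_rfl)
  have hAm' (t : ℕ) : Measurable (A t) := (hAm t).mono (ℱ.le t) le_rfl
  have hξm' (t : ℕ) : Measurable (ξ t) := (hξm t).mono (ℱ.le _) le_rfl
  have hsm' (n : ℕ) : Measurable (s n) := (hsm n).mono (ℱ.le n) le_rfl
  have hsn (n ω) : |s n ω| ≤ n := by
    refine (Finset.abs_sum_le_sum_abs _ _).trans ?_
    simpa using Finset.sum_le_sum fun t (_ : t ∈ range n) => hAξ1 t ω
  have hint {f : Ω → ℝ} {C : ℝ} (hf : Measurable f) (hC : ∀ ω, |f ω| ≤ C) : Integrable f Pr :=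
    Integrable.of_bound hf.aestronglyMeasurable C (.of_forall hC)
  have hsi (n : ℕ) : Integrable (s n) Pr := hint (hsm' n) (hsn n)
  have hξi (n : ℕ) : Integrable (ξ n) Pr := hint (hξm' n) (hξ n)
  have hAξi (n : ℕ) : Integrable (fun ω => A n ω * ξ n ω) Pr :=
    hint ((hAm' n).mul (hξm' n)) (hAξ1 n)
  have hcond (n : ℕ) : Pr[ξ n | ℱ n] =ᵐ[Pr] 0 := by
    have := condExp_indep_eq (μ := Pr) (hξm' n).comap_le (ℱ.le n)
      (comap_measurable (ξ n)).stronglyMeasurable (hindep n)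
    filter_upwards [this] with ω h
    simpa [hmean n] using h
  have hmart : Martingale s ℱ Pr := by
    refine martingale_of_condExp_sub_eq_zero_nat (fun n => (hsm n).stronglyMeasurable) hsi
      fun n => ?_
    have hd : s (n + 1) - s n = A n * ξ n := by
      ext ω; simp [hs, sum_range_succ]
    rw [hd]
    refine (condExp_mul_of_stronglyMeasurable_left (hAm n).stronglyMeasurable (hAξi n)
      (hξi n)).trans ?_
    filter_upwards [hcond n] with ω h
    simp [h]
  -- Martingale increments are orthogonal to the past, so the cross terms vanish in the second
  -- moment of `s`.
  have horth (n : ℕ) : ∫ ω, s n ω * A n ω * ξ n ω ∂Pr = 0 := by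
    have hi : IndepFun (fun ω => s n ω * A n ω) (ξ n) Pr := by
      rw [IndepFun_iff_Indep]
      exact (indep_of_indep_of_le_right (hindep n) ((hsm n).mul (hAm n)).comap_le).symm
    have := hi.integral_fun_mul_eq_mul_integral ((hsm' n).mul (hAm' n)).aestronglyMeasurable
      (hξm' n).aestronglyMeasurable
    rw [this, hmean n, mul_zero]
  have hA2i (n : ℕ) : Integrable (fun ω => A n ω ^ 2) Pr :=
    hint (C := 1) ((hAm' n).pow_const 2) fun ω => by
      rw [abs_pow]; exact pow_le_one₀ (abs_nonneg _) (hA1 n ω)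
  have hs2i (n : ℕ) : Integrable (fun ω => s n ω ^ 2) Pr :=
    hint (C := (n : ℝ) ^ 2) ((hsm' n).pow_const 2) fun ω => by
      rw [abs_pow]; exact pow_le_pow_left₀ (abs_nonneg _) (hsn n ω) 2
  have hsAi (n : ℕ) : Integrable (fun ω => s n ω * A n ω * ξ n ω) Pr :=
    hint (C := n) (((hsm' n).mul (hAm' n)).mul (hξm' n)) fun ω => by
      rw [mul_assoc, abs_mul]
      exact (mul_le_of_le_one_right (abs_nonneg _) (hAξ1 n ω)).trans (hsn n ω)
  have hL2 (n : ℕ) : ∫ ω, s n ω ^ 2 ∂Pr ≤ ∫ ω, ∑ t ∈ range n, A t ω ^ 2 ∂Pr := by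
    induction n with
    | zero => simp [hs]
    | succ n ih =>
      have hpt (ω : Ω) : s (n + 1) ω ^ 2 ≤
          s n ω ^ 2 + 2 * (s n ω * A n ω * ξ n ω) + A n ω ^ 2 := by
        have h1 : s (n + 1) ω = s n ω + A n ω * ξ n ω := by simp [hs, sum_range_succ]
        have h2 : ξ n ω ^ 2 ≤ 1 := by
          rw [← sq_abs]; exact pow_le_one₀ (abs_nonneg _) (hξ n ω)
        rw [h1]
        nlinarith [mul_le_mul_of_nonneg_left h2 (sq_nonneg (A n ω))]
      simp only [sum_range_succ]
      rw [integral_add (integrable_finsetSum _ fun t _ => hA2i t) (hA2i n)]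
      calc _ ≤ ∫ ω, s n ω ^ 2 + 2 * (s n ω * A n ω * ξ n ω) + A n ω ^ 2 ∂Pr :=
            integral_mono (hs2i _) (((hs2i n).add ((hsAi n).const_mul 2)).add (hA2i n)) hpt
        _ = ∫ ω, s n ω ^ 2 ∂Pr + ∫ ω, A n ω ^ 2 ∂Pr := by
            have h1 : Integrable (fun ω => s n ω ^ 2 + 2 * (s n ω * A n ω * ξ n ω)) Pr :=
              (hs2i n).add ((hsAi n).const_mul 2)
            rw [integral_add h1 (hA2i n), integral_add (hs2i n) ((hsAi n).const_mul 2),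
              integral_const_mul, horth n]
            ring
        _ ≤ _ := by gcongr
  -- From `|s| ≤ s ^ 2 + 1` and the second moment bound `2`. This L¹ bound is what martingale
  -- convergence requires.
  have hL1 (n : ℕ) : eLpNorm (s n) 1 Pr ≤ (3 : NNReal) := by
    have h2 : ∫ ω, ∑ t ∈ range n, A t ω ^ 2 ∂Pr ≤ 2 := by
      calc _ ≤ ∫ ω, (2 : ℝ) ∂Pr :=
            integral_mono (integrable_finsetSum _ fun t _ => hA2i t) (integrable_const _)
              fun ω => sum_sq_div_le_two (fun n => hI n ω) n
        _ = 2 := by simp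
    have h1 : ∫ ω, ‖s n ω‖ ∂Pr ≤ 3 := by
      calc _ ≤ ∫ ω, s n ω ^ 2 + 1 ∂Pr := by
            refine integral_mono (hsi n).norm ((hs2i n).add (integrable_const _)) fun ω => ?_
            simp only [Real.norm_eq_abs]
            nlinarith [sq_abs (s n ω), sq_nonneg (|s n ω| - 1), abs_nonneg (s n ω)]
        _ = ∫ ω, s n ω ^ 2 ∂Pr + 1 := by
            rw [integral_add (hs2i n) (integrable_const _)]; simp
        _ ≤ 3 := by linarith [hL2 n]
    rw [eLpNorm_one_eq_lintegral_enorm, ← ofReal_integral_norm_eq_lintegral_enorm (hsi n)]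
    exact (ENNReal.ofReal_le_ofReal h1).trans_eq (by norm_num)
  filter_upwards [hmart.submartingale.ae_tendsto_limitProcess hL1] with ω hω hN
  exact tendsto_weighted_average_zero (fun t => hI0 t ω) (by simp [hs])
    (fun n => by simp [hs, hA, sum_range_succ]) hω hN

end MartingaleLaw

/-! ### Consistency of the empirical kernel along a training run. -/

section TrainingRun

/-- The two hypotheses together say that `a`, `b`, `c` are mutually independent, so any one can be
split off; it suffices to check product sets. -/
lemma ProbabilityTheory.IndepFun.prodMk_right_of_prodMk {Ω A B C : Type*} [MeasurableSpace Ω]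
    [MeasurableSpace A] [MeasurableSpace B] [MeasurableSpace C] {Pr : Measure Ω}
    [IsProbabilityMeasure Pr] {a : Ω → A} {b : Ω → B} {c : Ω → C} (ha : Measurable a)
    (hb : Measurable b) (hc : Measurable c) (habc : IndepFun a (fun ω => (b ω, c ω)) Pr)
    (hbc : IndepFun b c Pr) : IndepFun b (fun ω => (a ω, c ω)) Pr := by
  have hac : IndepFun a c Pr := habc.comp measurable_id measurable_snd
  rw [indepFun_iff_map_prod_eq_prod_map_map (by fun_prop) (by fun_prop)]
  refine Measure.ext_prod₃ fun {s t q} hs ht hq => ?_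
  rw [Measure.map_apply (by fun_prop) (hs.prod (ht.prod hq)), Measure.prod_prod,
    Measure.map_apply hb hs, Measure.map_apply (by fun_prop) (ht.prod hq)]
  have e1 : (fun ω => (b ω, a ω, c ω)) ⁻¹' s ×ˢ t ×ˢ q =
      a ⁻¹' t ∩ (fun ω => (b ω, c ω)) ⁻¹' s ×ˢ q := by
    ext ω; simp only [Set.mem_preimage, Set.mem_prod, Set.mem_inter_iff]; tauto
  have e2 : (fun ω => (b ω, c ω)) ⁻¹' s ×ˢ q = b ⁻¹' s ∩ c ⁻¹' q := rfl
  have e3 : (fun ω => (a ω, c ω)) ⁻¹' t ×ˢ q = a ⁻¹' t ∩ c ⁻¹' q := rfl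
  rw [e1, habc.measure_inter_preimage_eq_mul _ _ ht (hs.prod hq), e2, e3,
    hbc.measure_inter_preimage_eq_mul _ _ hs hq, hac.measure_inter_preimage_eq_mul _ _ ht hq]
  ring

variable {Ω R X U Y W V : Type*} {mΩ : MeasurableSpace Ω} [MeasurableSpace R] [MeasurableSpace X]
  [MeasurableSpace U] [MeasurableSpace Y] [MeasurableSpace W] [MeasurableSpace V]
  {Pr : Measure Ω} {S : ControlledSystem X U Y W V} {η : TrainingPolicy R X Y U} {r : Ω → R}
  {w : ℕ → Ω → W} {v : ℕ → Ω → V} {x : ℕ → Ω → X} {y : ℕ → Ω → Y} {u : ℕ → Ω → U}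

namespace IsTrainingRun

/-- The random inputs that determine the run up to time `t`, together with all observation
noises. -/
def past (r : Ω → R) (w : ℕ → Ω → W) (v : ℕ → Ω → V) (x : ℕ → Ω → X) (t : ℕ) (ω : Ω) :
    (X × R) × ((ℕ → V) × (Finset.range t → W)) :=
  ((x 0 ω, r ω), (fun s => v s ω), fun i => w i ω)

lemma measurable_past (h : IsTrainingRun Pr S η r w v x y u) (t : ℕ) :
    Measurable (past r w v x t) :=
  (h.measurable_x0.prodMk h.measurable_r).prodMk
    ((measurable_pi_lambda _ h.measurable_v).prodMk
      (measurable_pi_lambda _ fun i => h.measurable_w i))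

/-- The filtration generated by the initial state, the seed, all observation noises, and the past
state noises. -/
def pastFiltration (h : IsTrainingRun Pr S η r w v x y u) : Filtration ℕ mΩ where
  seq t := MeasurableSpace.comap (past r w v x t) inferInstance
  mono' s t hst := by
    have hg : Measurable fun p : (X × R) × ((ℕ → V) × (Finset.range t → W)) =>
        (p.1, p.2.1, fun i : Finset.range s => p.2.2 ⟨i, Finset.range_mono hst i.2⟩) := by
      fun_prop
    exact (hg.comp (comap_measurable (past r w v x t))).comap_le
  le' t := (h.measurable_past t).comap_le

lemma measurable_noise (h : IsTrainingRun Pr S η r w v x y u) (t : ℕ) :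
    Measurable[h.pastFiltration (t + 1)] (w t) := by
  have hg : Measurable fun p : (X × R) × ((ℕ → V) × (Finset.range (t + 1) → W)) =>
      p.2.2 ⟨t, Finset.self_mem_range_succ t⟩ := by fun_prop
  exact hg.comp (comap_measurable (past r w v x (t + 1)))

/-- All observation noises belong to the filtration from the start, so only the state transition
consumes new information, namely `w t` between times `t` and `t + 1`. -/
lemma measurable_run (h : IsTrainingRun Pr S η r w v x y u) (t : ℕ) :
    Measurable[h.pastFiltration t] (x t) ∧ Measurable[h.pastFiltration t] (y t) ∧
      Measurable[h.pastFiltration t] (u t) := by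
  induction t using Nat.strong_induction_on with
  | _ t ih =>
    have hx : Measurable[h.pastFiltration t] (x t) := by
      cases t with
      | zero =>
        have hg : Measurable fun p : (X × R) × ((ℕ → V) × (Finset.range 0 → W)) => p.1.1 := by
          fun_prop
        exact hg.comp (comap_measurable (past r w v x 0))
      | succ t =>
        obtain ⟨h1, -, h3⟩ := ih t t.lt_succ_self
        have hle := h.pastFiltration.mono t.le_succ
        have := S.measurable_f.comp
          (((h1.mono hle le_rfl).prodMk (h3.mono hle le_rfl)).prodMk (h.measurable_noise t))
        exact (funext (h.state_eq t)) ▸ this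
    have hv : Measurable[h.pastFiltration t] (v t) := by
      have hg : Measurable fun p : (X × R) × ((ℕ → V) × (Finset.range t → W)) => p.2.1 t := by
        fun_prop
      exact hg.comp (comap_measurable (past r w v x t))
    have hr : Measurable[h.pastFiltration t] r := by
      have hg : Measurable fun p : (X × R) × ((ℕ → V) × (Finset.range t → W)) => p.1.2 := by
        fun_prop
      exact hg.comp (comap_measurable (past r w v x t))
    have hy : Measurable[h.pastFiltration t] (y t) := by
      have := S.measurable_g.comp (hx.prodMk hv)
      exact (funext (h.obs_eq t)) ▸ this
    refine ⟨hx, hy, ?_⟩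
    have hX : Measurable[h.pastFiltration t] fun ω => fun i : Finset.Iic t => x i ω := by
      refine @measurable_pi_lambda _ _ _ (h.pastFiltration t) _ _ fun i => ?_
      rcases (Finset.mem_Iic.1 i.2).lt_or_eq with hi | hi
      · exact (ih i hi).1.mono (h.pastFiltration.mono hi.le) le_rfl
      · rw [hi]; exact hx
    have hY : Measurable[h.pastFiltration t] fun ω => fun i : Finset.Iic t => y i ω := by
      refine @measurable_pi_lambda _ _ _ (h.pastFiltration t) _ _ fun i => ?_
      rcases (Finset.mem_Iic.1 i.2).lt_or_eq with hi | hi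
      · exact (ih i hi).2.1.mono (h.pastFiltration.mono hi.le) le_rfl
      · rw [hi]; exact hy
    have hU : Measurable[h.pastFiltration t] fun ω => fun i : Finset.Iio t => u i ω := by
      refine @measurable_pi_lambda _ _ _ (h.pastFiltration t) _ _ fun i => ?_
      have hi := Finset.mem_Iio.1 i.2
      exact (ih i hi).2.2.mono (h.pastFiltration.mono hi.le) le_rfl
    have := (η.measurable_act t).comp (hr.prodMk (hX.prodMk (hY.prodMk hU)))
    exact (funext (h.act_eq t)) ▸ this

variable [IsProbabilityMeasure Pr]

/-- The past is assembled block by block: earlier state noises, then the observation noises, then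
`(x 0, r)`. Each new block is independent of everything already present together with `w t`. -/
lemma indepFun_noise_past (h : IsTrainingRun Pr S η r w v x y u) (t : ℕ) :
    IndepFun (w t) (past r w v x t) Pr := by
  have hwt : Measurable fun q : ({t} : Finset ℕ) → W => q ⟨t, Finset.mem_singleton_self t⟩ := by
    fun_prop
  have hw1 : IndepFun (w t) (fun ω => fun i : Finset.range t => w i ω) Pr :=
    (h.indep_w.indepFun_finset {t} (Finset.range t) (by simp) h.measurable_w).comp hwt
      measurable_id
  have hv : Measurable fun ω => fun s => v s ω := measurable_pi_lambda _ h.measurable_v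
  have hwr : Measurable fun ω => fun i : Finset.range t => w i ω :=
    measurable_pi_lambda _ fun i => h.measurable_w i
  have hm1 : Measurable fun p : ℕ → W => (p t, fun i : Finset.range t => p i) := by fun_prop
  have hw2 : IndepFun (w t) (fun ω => ((fun s => v s ω), fun i : Finset.range t => w i ω)) Pr :=
    IndepFun.prodMk_right_of_prodMk hv (h.measurable_w t) hwr
      (h.indep_w_v.symm.comp measurable_id hm1) hw1
  have hm2 : Measurable fun p : (ℕ → W) × (ℕ → V) =>
      (p.1 t, p.2, fun i : Finset.range t => p.1 i) := by fun_prop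
  exact IndepFun.prodMk_right_of_prodMk (h.measurable_x0.prodMk h.measurable_r)
    (h.measurable_w t) (hv.prodMk hwr) (h.indep_x0_r.comp measurable_id hm2) hw2

variable [Finite X] [MeasurableSingletonClass X] [Finite U] [MeasurableSingletonClass U]

/-- Consistency of the empirical transition frequencies. -/
lemma ae_tendsto_empiricalKernel (h : IsTrainingRun Pr S η r w v x y u)
    (d : Kernel (X × U) X) (a a' : X) (b : U) :
    ∀ᵐ ω ∂Pr, (∃ᶠ t in atTop, x t ω = a ∧ u t ω = b) →
      Tendsto (fun n => (empiricalKernel d (fun t => x t ω) (fun t => u t ω) n (a, b)).real {a'})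
        atTop (𝓝 ((S.transition (a, b)).real {a'})) := by
  classical
  set p : ℝ := (S.transition (a, b)).real {a'} with hp
  set E : Set W := S.f a b ⁻¹' {a'} with hE
  have hfm : Measurable (S.f a b) := S.measurable_f.comp (measurable_prodMk_left (x := (a, b)))
  have hEm : MeasurableSet E := hfm (measurableSet_singleton a')
  have hpE : p = (S.μ : Measure W).real E := by
    rw [hp, S.transition_apply, map_measureReal_apply hfm (measurableSet_singleton a')]
  have hp0 : 0 ≤ p := measureReal_nonneg
  have hp1 : p ≤ 1 := by rw [hpE]; exact measureReal_le_one
  set I : ℕ → Ω → ℝ := fun t ω => if x t ω = a ∧ u t ω = b then 1 else 0 with hI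
  -- The centred indicator that the noise sends `(a, b)` to `a'`.
  set φ : W → ℝ := fun q => E.indicator 1 q - p with hφ
  have hφm : Measurable φ := (measurable_one.indicator hEm).sub_const p
  have hφ1 (q : W) : |φ q| ≤ 1 := by
    by_cases hq : q ∈ E
    · simp only [hφ, Set.indicator_of_mem hq, Pi.one_apply, abs_le]; constructor <;> linarith
    · simp only [hφ, Set.indicator_of_notMem hq, abs_le]; constructor <;> linarith
  have hφ0 : ∫ q, φ q ∂(S.μ : Measure W) = 0 := by
    rw [hφ, integral_sub ((integrable_const _).indicator hEm) (integrable_const _),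
      integral_indicator_one hEm, integral_const, hpE]
    simp
  have key := ae_tendsto_selected_average_zero (Pr := Pr) h.pastFiltration (I := I)
    (ξ := fun t ω => φ (w t ω))
    (fun t => by
      obtain ⟨hx, -, hu⟩ := h.measurable_run t
      exact Measurable.ite ((hx (measurableSet_singleton a)).inter (hu (measurableSet_singleton b)))
        measurable_const measurable_const)
    (fun t ω => by simp only [hI]; split_ifs <;> simp)
    (fun t => hφm.comp (h.measurable_noise t))
    (fun t ω => hφ1 _)
    (fun t => by
      rw [← hφ0, ← h.law_w t,
        integral_map (h.measurable_w t).aemeasurable hφm.aestronglyMeasurable])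
    (fun t => (h.indepFun_noise_past t).comp hφm measurable_id)
  filter_upwards [key] with ω hω hfreq
  have hcard (n : ℕ) : ∑ i ∈ Finset.range n, I i ω =
      (((Finset.range n).filter fun i => x i ω = a ∧ u i ω = b).card : ℝ) := by
    simp [hI]
  have hN : Tendsto (fun n => ∑ i ∈ Finset.range n, I i ω) atTop atTop := by
    simp only [hcard]
    refine tendsto_natCast_atTop_atTop.comp ?_
    refine tendsto_atTop_atTop_of_monotone (fun m n hmn => Finset.card_le_card
      (Finset.filter_subset_filter _ (Finset.range_mono hmn))) fun k => ?_
    obtain ⟨F, hF, hFk⟩ := (Nat.frequently_atTop_iff_infinite.1 hfreq).exists_subset_card_eq k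
    obtain ⟨n, hn⟩ := F.exists_nat_subset_range
    refine ⟨n, hFk ▸ Finset.card_le_card fun i hi => ?_⟩
    exact Finset.mem_filter.2 ⟨hn hi, hF hi⟩
  have hlim := (hω hN).const_add p
  rw [add_zero] at hlim
  refine hlim.congr' ?_
  -- From the first visit on, the initial guess `d` no longer enters the estimate.
  filter_upwards [hN.eventually_gt_atTop 0] with n hn
  have hne : visitTimes (fun t => x t ω) (fun t => u t ω) n a b ≠ ∅ := by
    intro he
    have : (Finset.range n).filter (fun i => x i ω = a ∧ u i ω = b) = ∅ := by
      rw [← he, visitTimes]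
    rw [hcard, this] at hn
    simp at hn
  -- The count of transitions to `a'` equals its conditional mean, `p` per visit, plus the centred
  -- sum controlled by the strong law.
  have hnum : ∑ i ∈ Finset.range n, I i ω * φ (w i ω) + p * ∑ i ∈ Finset.range n, I i ω =
      (((Finset.range n).filter fun i => x (i + 1) ω ∈ ({a'} : Set X) ∧ x i ω = a ∧
        u i ω = b).card : ℝ) := by
    rw [Finset.mul_sum, ← Finset.sum_add_distrib, Finset.card_filter, Nat.cast_sum]
    refine Finset.sum_congr rfl fun i _ => ?_
    by_cases hi : x i ω = a ∧ u i ω = b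
    · have : x (i + 1) ω ∈ ({a'} : Set X) ↔ w i ω ∈ E := by
        rw [h.state_eq, hi.1, hi.2]; rfl
      by_cases hE' : w i ω ∈ E <;> simp [hI, hφ, hi, this, hE']
    · simp [hI, hi]
  have hemp : (empiricalKernel d (fun t => x t ω) (fun t => u t ω) n (a, b)).real {a'} =
      (((Finset.range n).filter fun i => x (i + 1) ω ∈ ({a'} : Set X) ∧ x i ω = a ∧
        u i ω = b).card : ℝ) / ((Finset.range n).filter fun i => x i ω = a ∧ u i ω = b).card := by
    have := empiricalMeasure_apply d (fun t => x t ω) (fun t => u t ω) n a b hne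
      (measurableSet_singleton a')
    change (empiricalMeasure d (fun t => x t ω) (fun t => u t ω) n a b).real {a'} = _
    rw [measureReal_def, this, ENNReal.toReal_div, ENNReal.toReal_natCast, ENNReal.toReal_natCast]
    congr!
  rw [hemp, ← hnum, ← hcard]
  field_simp
  ring

end IsTrainingRun

end TrainingRun

lemma abs_ciInf_sub_ciInf_le {ι : Type*} {f g : ι → ℝ} {e : ℝ} (he : 0 ≤ e)
    (hf : BddBelow (Set.range f)) (hg : BddBelow (Set.range g)) (h : ∀ i, |f i - g i| ≤ e) :
    |(⨅ i, f i) - ⨅ i, g i| ≤ e := by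
  rcases isEmpty_or_nonempty ι with _ | _
  · simpa [Real.iInf_of_isEmpty] using he
  · have h1 : (⨅ i, f i) - e ≤ ⨅ i, g i := le_ciInf fun i => by
      linarith [ciInf_le hf i, (abs_le.1 (h i)).2]
    have h2 : (⨅ i, g i) - e ≤ ⨅ i, f i := le_ciInf fun i => by
      linarith [ciInf_le hg i, (abs_le.1 (h i)).1]
    rw [abs_le]
    constructor <;> linarith

/-! ### From convergence of kernels to convergence of optimal costs and policies. -/

section Robustness

variable {X Y U : Type*} [MeasurableSpace X] [MeasurableSpace Y] [MeasurableSpace U] [Fintype X]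
  [Fintype U] [MeasurableSingletonClass X] [MeasurableSingletonClass U]

/-- Continuity of the optimal cost in the transition kernel, and asymptotic optimality of the
policies that are optimal for the approximating kernels. -/
lemma tendsto_optimalCost_and_discountedCost {β : ℝ} (hβ0 : 0 < β) (hβ1 : β < 1) (c : X → U → ℝ)
    (P : Measure X) [IsProbabilityMeasure P] (Q : Kernel X Y) [IsMarkovKernel Q]
    (T : Kernel (X × U) X) [IsMarkovKernel T] (Tn : ℕ → Kernel (X × U) X)
    [∀ n, IsMarkovKernel (Tn n)]
    (hT : Tendsto (fun n => kernelDist (Tn n) T) atTop (𝓝 0)) :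
    Tendsto (fun n => optimalCost β c P (Tn n) Q) atTop (𝓝 (optimalCost β c P T Q)) ∧
      ∀ γ : ℕ → AdmissiblePolicy Y U, (∀ n, 1 ≤ n → IsOptimalPolicy β c P (Tn n) Q (γ n)) →
        Tendsto (fun n => discountedCost β c P T Q (γ n)) atTop (𝓝 (optimalCost β c P T Q)) := by
  obtain ⟨L, hL0, hL⟩ := exists_abs_discountedCost_sub_le hβ0 hβ1 c P Q
  obtain ⟨B, hB⟩ := exists_abs_discountedCost_le hβ0 hβ1 c P Q
  have hbdd (T : Kernel (X × U) X) [IsMarkovKernel T] :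
      BddBelow (Set.range fun γ : AdmissiblePolicy Y U => discountedCost β c P T Q γ) :=
    ⟨-B, by rintro _ ⟨γ, rfl⟩; exact (abs_le.1 (hB T γ)).1⟩
  have hlim : Tendsto (fun n => L * kernelDist (Tn n) T) atTop (𝓝 0) := by
    simpa using hT.const_mul L
  have hopt : Tendsto (fun n => optimalCost β c P (Tn n) Q) atTop
      (𝓝 (optimalCost β c P T Q)) := by
    refine tendsto_iff_norm_sub_tendsto_zero.2
      (squeeze_zero (fun _ => norm_nonneg _) (fun n => ?_) hlim)
    exact abs_ciInf_sub_ciInf_le (mul_nonneg hL0 (kernelDist_nonneg _ _)) (hbdd _) (hbdd _)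
      fun γ => hL _ _ γ
  refine ⟨hopt, fun γ hγ => ?_⟩
  -- The policy varies with `n`, so the Lipschitz constant has to be uniform over policies.
  have hdiff : Tendsto (fun n => discountedCost β c P (Tn n) Q (γ n) -
      discountedCost β c P T Q (γ n)) atTop (𝓝 0) :=
    squeeze_zero_norm (fun n => hL _ _ _) hlim
  have := hopt.sub hdiff
  rw [sub_zero] at this
  refine this.congr' ?_
  filter_upwards [eventually_ge_atTop 1] with n hn
  rw [← hγ n hn, sub_sub_cancel]

end Robustness

theorem mainTheorem11
    {Ω R X U Y W V : Type*} [MeasurableSpace Ω] [MeasurableSpace R]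
    [MeasurableSpace Y] [MeasurableSpace W] [MeasurableSpace V]
    [Finite X] [MeasurableSpace X] [MeasurableSingletonClass X]
    [Finite U] [MeasurableSpace U] [MeasurableSingletonClass U]
    -- the unknown system, and the control problem
    (S : ControlledSystem X U Y W V)
    (β : ℝ) (hβ0 : 0 < β) (hβ1 : β < 1) (c : X → U → ℝ)
    (P : Measure X) [IsProbabilityMeasure P]
    -- the training run, in which every state-action pair is visited infinitely often
    (Pr : Measure Ω) [IsProbabilityMeasure Pr]
    (η : TrainingPolicy R X Y U) (r : Ω → R) (w : ℕ → Ω → W) (v : ℕ → Ω → V)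
    (x : ℕ → Ω → X) (y : ℕ → Ω → Y) (u : ℕ → Ω → U)
    (hrun : IsTrainingRun Pr S η r w v x y u)
    (hvisit : ∀ᵐ ω ∂Pr, ∀ (a : X) (b : U), ∃ᶠ t in atTop, x t ω = a ∧ u t ω = b)
    -- the estimate that is used for pairs that have not been visited yet
    (d : Kernel (X × U) X) [IsMarkovKernel d] :
    ∀ᵐ ω ∂Pr,
      Tendsto
        (fun n => optimalCost β c P
          (empiricalKernel d (fun t => x t ω) (fun t => u t ω) n) S.channel)
        atTop (𝓝 (optimalCost β c P S.transition S.channel)) ∧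
      ∀ γ : ℕ → AdmissiblePolicy Y U,
        (∀ n, 1 ≤ n → IsOptimalPolicy β c P
          (empiricalKernel d (fun t => x t ω) (fun t => u t ω) n) S.channel (γ n)) →
        Tendsto (fun n => discountedCost β c P S.transition S.channel (γ n))
          atTop (𝓝 (optimalCost β c P S.transition S.channel)) := by
  cases nonempty_fintype X
  cases nonempty_fintype U
  -- Only finitely many triples occur, so one null set serves for all. It involves no policy, hence
  -- the policies may depend on `ω` arbitrarily.
  have hcons : ∀ᵐ ω ∂Pr, ∀ (p : X × U) (a' : X), (∃ᶠ t in atTop, x t ω = p.1 ∧ u t ω = p.2) →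
      Tendsto (fun n => (empiricalKernel d (fun t => x t ω) (fun t => u t ω) n p).real {a'})
        atTop (𝓝 ((S.transition p).real {a'})) := by
    rw [ae_all_iff]
    intro p
    rw [ae_all_iff]
    exact fun a' => hrun.ae_tendsto_empiricalKernel d p.1 a' p.2
  filter_upwards [hvisit, hcons] with ω hv hc
  refine tendsto_optimalCost_and_discountedCost hβ0 hβ1 c P S.channel S.transition
    (fun n => empiricalKernel d (fun t => x t ω) (fun t => u t ω) n) ?_
  have : Tendsto (fun n => ∑ p : X × U, ∑ a : X,
      |(empiricalKernel d (fun t => x t ω) (fun t => u t ω) n p).real {a} -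
        (S.transition p).real {a}|) atTop (𝓝 (∑ _p : X × U, ∑ _a : X, 0)) := by
    refine tendsto_finsetSum _ fun p _ => tendsto_finsetSum _ fun a _ => ?_
    simpa using ((hc p a (hv p.1 p.2)).sub_const ((S.transition p).real {a})).abs
  simpa [kernelDist] using this
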